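/- Let $a_n$ be the number of 3D rook paths from $(0,0,0)$ to $(n,n,n)$, that is, the number of finite sequences of vectors, each of the form $(m,0,0)$, $(0,m,0)$ or $(0,0,m)$ with an integer $m\ge 1$, whose sum is $(n,n,n)$. Let $G(x)=\sum_{n\ge 0}a_nx^n\in\mathbb{Q}[[x]]$, and let $${}_2F_1(\alpha,\beta;\gamma;z)=\sum_{n\ge 0}\frac{(\alpha)_n(\beta)_n}{(\gamma)_n}\,\frac{z^n}{n!},\qquad (\alpha)_n=\alpha(\alpha+1)\cdots(\alpha+n-1).$$ Then the following identities hold in $\mathbb{Q}[[x]]$, where rational functions without a pole at $0$ are identified with their power series expansions at $0$, and the derivative and $\int_0^x$ are the formal ones (in particular $\int_0^x \sum_{n\ge0} f_n w^n\,dw=\sum_{n\ge0} f_n\frac{x^{n+1}}{n+1}$): $$G'(x)=\frac{6}{(1-4x)(1-64x)}\;{}_2F_1\!\left(\tfrac13,\tfrac23;2;\frac{27x(2-3x)}{(1-4x)^3}\right)$$ and $$G(x)=1+6\int_0^x\frac{1}{(1-4w)(1-64w)}\;{}_2F_1\!\left(\tfrac13,\tfrac23;2;\frac{27w(2-3w)}{(1-4w)^3}\right)dw.$$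 -/

import Mathlib

namespace Rook3D

/-- The moves of a 3D rook that bring it closer to the goal: positive integer multiples of
`(1,0,0)`, `(0,1,0)` or `(0,0,1)`. -/
def IsMove (v : ℕ × ℕ × ℕ) : Prop :=
  ∃ m : ℕ, 1 ≤ m ∧ (v = (m, 0, 0) ∨ v = (0, m, 0) ∨ v = (0, 0, m))

/-- The rook paths from `(0,0,0)` to the cell `p`: finite sequences of moves whose total
displacement is `p`. -/
def paths (p : ℕ × ℕ × ℕ) : Set (List (ℕ × ℕ × ℕ)) :=
  {l | (∀ v ∈ l, IsMove v) ∧ l.sum = p}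

/-- There are finitely many rook paths to a given cell, so that counting them by `Set.ncard`
is meaningful. -/
theorem paths_finite (p : ℕ × ℕ × ℕ) : (paths p).Finite := by
  obtain ⟨N, hN⟩ : ∃ N, p.1 + p.2.1 + p.2.2 = N := ⟨_, rfl⟩
  induction N using Nat.strong_induction_on generalizing p with
  | _ N ih =>
    have hsub : paths p ⊆ {[]} ∪ ⋃ q ∈ {q : (ℕ × ℕ × ℕ) × (ℕ × ℕ × ℕ) |
        (q.1 ∈ Set.Iic p ∧ q.2 ∈ Set.Iic p) ∧ q.2.1 + q.2.2.1 + q.2.2.2 < N},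
        (List.cons q.1) '' paths q.2 := by
      rintro l ⟨hl, hs⟩
      cases l with
      | nil => exact Or.inl rfl
      | cons v l =>
        right
        rw [List.sum_cons] at hs
        have hv : IsMove v := hl v (by simp)
        refine Set.mem_biUnion (x := (v, l.sum)) ?_
          ⟨l, ⟨fun w hw => hl w (by simp [hw]), rfl⟩, rfl⟩
        obtain ⟨a, b, c⟩ := v
        obtain ⟨i, j, k⟩ := p
        generalize l.sum = s at hs ⊢
        obtain ⟨s1, s2, s3⟩ := s
        obtain ⟨m, hm, h⟩ := hv
        simp only [Prod.mk_add_mk, Prod.mk.injEq] at hs h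
        simp only [Set.mem_ofPred_eq, Set.mem_Iic, Prod.mk_le_mk]
        simp only at hN
        omega
    refine Set.Finite.subset ((Set.finite_singleton _).union ?_) hsub
    refine Set.Finite.biUnion ?_ ?_
    · exact ((Set.finite_Iic p).prod (Set.finite_Iic p)).subset fun q hq => hq.1
    · intro q hq
      exact (ih _ hq.2 q.2 rfl).image _

/-- `r p` is the number of rook paths from `(0,0,0)` to the cell `p`. -/
noncomputable def r (p : ℕ × ℕ × ℕ) : ℕ := (paths p).ncard

/-- The 3D diagonal rook sequence. -/
noncomputable def a (n : ℕ) : ℕ := r (n, n, n)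

/-- The generating series of the 3D diagonal rook sequence. -/
noncomputable def G : PowerSeries ℚ := PowerSeries.mk fun n => (a n : ℚ)

/-- The Gaussian hypergeometric series with parameters `α`, `β`, `γ` as a formal power series:
its `n`-th coefficient is `(α)_n (β)_n / ((γ)_n n!)`. -/
noncomputable def hyp (α β γ : ℚ) : PowerSeries ℚ :=
  PowerSeries.mk fun n => ordinaryHypergeometricCoefficient α β γ n

/-- The rational function `27 x (2 - 3 x) / (1 - 4 x) ^ 3`, expanded at `0`. -/
noncomputable def arg : PowerSeries ℚ :=
  27 * PowerSeries.X * (2 - 3 * PowerSeries.X) * ((1 - 4 * PowerSeries.X) ^ 3)⁻¹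

/-- The inverse in the definition of `arg` is a genuine one. -/
theorem arg_mul : arg * (1 - 4 * PowerSeries.X) ^ 3
    = 27 * PowerSeries.X * (2 - 3 * PowerSeries.X) := by
  rw [arg, mul_assoc, PowerSeries.inv_mul_cancel _ (by simp), mul_one]

/-- The argument of the hypergeometric series has no constant term, so that the substitution
is well defined. -/
theorem hasSubst_arg : PowerSeries.HasSubst arg :=
  PowerSeries.HasSubst.of_constantCoeff_zero' (by simp [arg])

/-- The formal integral `∫₀ˣ f(w) dw`, that is, the sum of the `f_n x^(n+1) / (n+1)`. -/
noncomputable def integral (f : PowerSeries ℚ) : PowerSeries ℚ :=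
  PowerSeries.X * PowerSeries.mk fun n => PowerSeries.coeff n f / ((n : ℚ) + 1)

end Rook3D

/-!
The generating function of all 3D rook paths is the expansion of `N / D`, where
`N = (1 - x)(1 - y)(1 - z)` and `D = 1 - 2(x + y + z) + 3(xy + yz + zx) - 4xyz`
(`denom_mul_rookSeries`), and `G` is its diagonal. The Euler operators `x ∂/∂x`, `y ∂/∂y`, `z ∂/∂z`
all induce `X d/dX` on diagonals, so differences of their values have diagonal zero, while
multiplication by `w = xyz` becomes multiplication by `X`. Creative telescoping therefore applies:
an identity expressing a combination of Euler derivatives with coefficients in `ℚ[w]` as such a sum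
of differences gives a differential equation for the diagonals.

Besides `G`, let `b` be the diagonal of `1 / D`. Two telescoping identities,
`IsEuler.first_telescoper` and `IsEuler.second_telescoper`, give
`2(1 + 6X) G' = (1 - X) ((1 - 4X) b)'` and, with `Q = (2 - 3X)(1 - 64X)`,
`(1 - 4X)(X Q G')' + 8 X Q G' = 12(1 - X)(1 + 6X) b`.

The right-hand sides of the theorem satisfy the same system: with `z = 27X(2 - 3X)/(1 - 4X)^3`,
the pair `6 ₂F₁(1/3, 2/3; 2; z) / ((1 - 4X)(1 - 64X))`, `₂F₁(1/3, 2/3; 1; z) / (1 - 4X)` is a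
solution, because `z' = 54(1 - X)(1 + 6X)/(1 - 4X)^4`,
`1 - z = (1 - X)^2 (1 - 64X)/(1 - 4X)^3`, and `₂F₁(1/3, 2/3; 1; z)` is the derivative of
`z ₂F₁(1/3, 2/3; 2; z)`. A solution of the system is determined by the constant term of its second
component (`eq_zero_of_system`), which is `1` for both.
-/

namespace Rook3D

/-! ### Telescoping identities -/

section Certificates

variable {R : Type*} [CommRing R] [Algebra ℚ R]

theorem derivation_ofNat (θ : Derivation ℚ R R) (n : ℕ) [n.AtLeastTwo] :
    θ (ofNat(n) : R) = 0 := by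
  rw [← Nat.cast_ofNat]
  exact θ.map_natCast _

theorem derivation_mul_inv (θ : Derivation ℚ R R) {D I : R} (h : D * I = 1) (A : R) :
    θ (A * I) = (θ A * D - A * θ D) * I ^ 2 := by
  have hI := θ.leibniz_of_mul_eq_one (a := I) (b := D) (by rw [mul_comm, h])
  simp only [Derivation.leibniz, hI, smul_eq_mul]
  linear_combination (-I * θ A) * h

theorem derivation_mul_inv_sq (θ : Derivation ℚ R R) {D I : R} (h : D * I = 1) (A : R) :
    θ (A * I ^ 2) = (θ A * D - 2 * A * θ D) * I ^ 3 := by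
  have hI := θ.leibniz_of_mul_eq_one (a := I) (b := D) (by rw [mul_comm, h])
  simp only [Derivation.leibniz, Derivation.leibniz_pow, hI, smul_eq_mul, nsmul_eq_mul,
    Nat.reduceSub, pow_one]
  push_cast
  linear_combination (-I ^ 2 * θ A) * h

/-- The derivations `θ 0`, `θ 1`, `θ 2` act on `x`, `y`, `z` as the Euler operators
`x ∂/∂x`, `y ∂/∂y`, `z ∂/∂z`. -/
structure IsEuler (θ : Fin 3 → Derivation ℚ R R) (x y z : R) : Prop where
  x0 : θ 0 x = x
  y0 : θ 0 y = 0
  z0 : θ 0 z = 0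
  x1 : θ 1 x = 0
  y1 : θ 1 y = y
  z1 : θ 1 z = 0
  x2 : θ 2 x = 0
  y2 : θ 2 y = 0
  z2 : θ 2 z = z

/-- The denominator of the generating function of 3D rook paths. -/
def denom (x y z : R) : R :=
  1 - 2 * (x + y + z) + 3 * (x * y + y * z + z * x) - 4 * (x * y * z)

variable {θ : Fin 3 → Derivation ℚ R R} {x y z I : R}

theorem IsEuler.apply_numer_mul_inv (h : IsEuler θ x y z) (hI : denom x y z * I = 1) :
    θ 0 ((1 - x) * (1 - y) * (1 - z) * I) = x * ((1 - y) * (1 - z)) ^ 2 * I ^ 2 := by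
  rw [derivation_mul_inv _ hI, denom]
  simp only [map_add, map_sub, Derivation.leibniz, derivation_ofNat, Derivation.map_one_eq_zero,
    h.x0, h.y0, h.z0, smul_eq_mul]
  ring

/-- With `w = x y z`, `N = (1 - x)(1 - y)(1 - z)` and `D = 1 / I`, the combination
`2 (1 + 6 w) θ(N/D) - (1 - w) θ((1 - 4 w)/D)`, where `θ = θ 0`, is exact, that is, of the form
`(θ 0 A - θ 2 A) + (θ 1 B - θ 2 B)`. The certificates `A` and `B` have a simple pole along `D = 0`;
the factor `3` makes their coefficients integral. -/
theorem IsEuler.first_telescoper (h : IsEuler θ x y z) (hI : denom x y z * I = 1) :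
    ∃ A B : R,
      3 * ((2 + 12 * (x * y * z)) * θ 0 ((1 - x) * (1 - y) * (1 - z) * I)
        - (1 - x * y * z) * θ 0 ((1 - 4 * (x * y * z)) * I))
      = (θ 0 A - θ 2 A) + (θ 1 B - θ 2 B) := by
  refine ⟨((1 + 26 * (x * y * z))
        + (-2 - 12 * (x * y * z)) * z
        + (-2 - 12 * (x * y * z)) * y
        + (-2) * x
        + (3) * y * z) * I,
    ((-15 * (x * y * z))
        + (12 * (x * y * z)) * y
        + (3) * x * z) * I, ?_⟩
  rw [h.apply_numer_mul_inv hI]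
  simp only [derivation_mul_inv _ hI, denom]
  simp only [map_add, map_sub, map_neg, Derivation.leibniz, derivation_ofNat,
    Derivation.map_one_eq_zero, h.x0, h.y0, h.z0, h.x1, h.y1, h.z1, h.x2, h.y2, h.z2, smul_eq_mul]
  ring

/-- The second order relation between `N/D` and `1/D` modulo exact elements, in the notation of
`IsEuler.first_telescoper`. The certificates `A` and `B` have a double pole along `D = 0`;
the coefficients of their numerators solve a linear system over `ℚ`, and the factor `18` makes them
integral. -/
theorem IsEuler.second_telescoper (h : IsEuler θ x y z) (hI : denom x y z * I = 1) :
    ∃ A B : R,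
      18 * ((1 - 4 * (x * y * z)) * θ 0 ((2 - 3 * (x * y * z)) * (1 - 64 * (x * y * z)) *
          θ 0 ((1 - x) * (1 - y) * (1 - z) * I))
        + 8 * (x * y * z) * ((2 - 3 * (x * y * z)) * (1 - 64 * (x * y * z)) *
          θ 0 ((1 - x) * (1 - y) * (1 - z) * I))
        - 12 * (x * y * z) * ((1 - x * y * z) * (1 + 6 * (x * y * z)) * I))
      = (θ 0 A - θ 2 A) + (θ 1 B - θ 2 B) := by
  refine ⟨((-840 * (x * y * z) - 9216 * (x * y * z) ^ 2 + 50544 * (x * y * z) ^ 3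
          - 52800 * (x * y * z) ^ 4)
        + (1340 * (x * y * z) + 12031 * (x * y * z) ^ 2 - 30204 * (x * y * z) ^ 3
          + 28800 * (x * y * z) ^ 4) * z
        + (1930 * (x * y * z) + 2237 * (x * y * z) ^ 2 - 19284 * (x * y * z) ^ 3
          + 25344 * (x * y * z) ^ 4) * y
        + (36 - 96 * (x * y * z) + 13440 * (x * y * z) ^ 2 - 11328 * (x * y * z) ^ 3) * x
        + (-1380 * (x * y * z) - 1680 * (x * y * z) ^ 2) * z ^ 2
        + (-228 * (x * y * z) - 3300 * (x * y * z) ^ 2 + 13104 * (x * y * z) ^ 3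
          - 13824 * (x * y * z) ^ 4) * y * z
        + (-1380 * (x * y * z) - 1680 * (x * y * z) ^ 2) * y ^ 2
        + (-54 + 1200 * (x * y * z) - 32376 * (x * y * z) ^ 2 + 28080 * (x * y * z) ^ 3) * x * z
        + (-72 + 1512 * (x * y * z) - 27576 * (x * y * z) ^ 2 + 23760 * (x * y * z) ^ 3) * x * y
        + (-768 * (x * y * z) + 192 * (x * y * z) ^ 2) * x ^ 2
        + (2304 * (x * y * z) - 576 * (x * y * z) ^ 2) * y ^ 2 * z
        + (36 - 432 * (x * y * z) + 15408 * (x * y * z) ^ 2 - 13824 * (x * y * z) ^ 3) * x * z ^ 2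
        + (36 - 432 * (x * y * z) + 15408 * (x * y * z) ^ 2 - 13824 * (x * y * z) ^ 3) * x * y ^ 2
        + (2304 * (x * y * z) - 576 * (x * y * z) ^ 2) * x ^ 2 * z
        + (-1728 * (x * y * z) + 432 * (x * y * z) ^ 2) * y ^ 2 * z ^ 2) * I ^ 2,
    ((540 * (x * y * z) + 8640 * (x * y * z) ^ 2 + 31752 * (x * y * z) ^ 3
          - 14688 * (x * y * z) ^ 4)
        + (184 * (x * y * z) - 13153 * (x * y * z) ^ 2 - 32028 * (x * y * z) ^ 3
          + 19584 * (x * y * z) ^ 4) * z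
        + (-1080 * (x * y * z) - 5274 * (x * y * z) ^ 2 - 25560 * (x * y * z) ^ 3
          + 13824 * (x * y * z) ^ 4) * y
        + (128 * (x * y * z) - 224 * (x * y * z) ^ 2 + 48 * (x * y * z) ^ 3) * x
        + (-975 * (x * y * z) + 9066 * (x * y * z) ^ 2 + 18792 * (x * y * z) ^ 3
          - 13824 * (x * y * z) ^ 4) * y * z
        + (612 * (x * y * z) + 1872 * (x * y * z) ^ 2) * y ^ 2
        + (-72 - 4056 * (x * y * z) - 6888 * (x * y * z) ^ 2 + 2736 * (x * y * z) ^ 3) * x * z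
        + (72 + 4932 * (x * y * z) + 13248 * (x * y * z) ^ 2 - 6912 * (x * y * z) ^ 3) * x * z ^ 2
        + (-1728 * (x * y * z) + 432 * (x * y * z) ^ 2) * x ^ 2 * z ^ 2) * I ^ 2, ?_⟩
  rw [h.apply_numer_mul_inv hI, ← mul_assoc (_ * _) _ (I ^ 2)]
  simp only [derivation_mul_inv_sq _ hI]
  -- Everything is brought over the common denominator `denom x y z ^ 3`.
  have hI1 : I = denom x y z ^ 2 * I ^ 3 := by
    linear_combination (-(denom x y z * I + 1) * I) * hI
  have hI2 : I ^ 2 = denom x y z * I ^ 3 := by linear_combination (-I ^ 2) * hI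
  rw [hI2]
  conv_lhs => enter [2, 2]; rw [hI1]
  simp only [denom]
  simp only [map_add, map_sub, map_neg, Derivation.leibniz, Derivation.leibniz_pow,
    derivation_ofNat, Derivation.map_one_eq_zero, h.x0, h.y0, h.z0, h.x1, h.y1, h.z1, h.x2, h.y2,
    h.z2, smul_eq_mul, nsmul_eq_mul, Nat.reduceSub, pow_one]
  push_cast
  ring

end Certificates

/-! ### Diagonals of power series in three variables -/

section Diagonal

open MvPowerSeries

/-- The Euler operator `Xᵢ ∂/∂Xᵢ` on power series in three variables. -/
noncomputable def euler (i : Fin 3) :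
    Derivation ℚ (MvPowerSeries (Fin 3) ℚ) (MvPowerSeries (Fin 3) ℚ) :=
  (X i : MvPowerSeries (Fin 3) ℚ) • pderiv ℚ i

theorem coeff_euler (i : Fin 3) (f : MvPowerSeries (Fin 3) ℚ) (n : Fin 3 →₀ ℕ) :
    coeff n (euler i f) = n i * coeff n f := by
  rw [euler, Derivation.smul_apply, smul_eq_mul, X_def, coeff_monomial_mul]
  split_ifs with h
  · have h1 : 1 ≤ n i := by simpa using h i
    rw [coeff_pderiv, tsub_add_cancel_of_le h, one_mul, Finsupp.tsub_apply,
      Finsupp.single_eq_same, Nat.cast_sub h1]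
    push_cast
    ring
  · have h0 : n i = 0 := by
      rw [Finsupp.single_le_iff] at h
      omega
    simp [h0]

theorem euler_X_self (i : Fin 3) : euler i (X i) = X i := by simp [euler]

theorem euler_X_of_ne {i j : Fin 3} (h : j ≠ i) : euler i (X j) = 0 := by
  simp [euler, pderiv_X_of_ne h]

theorem isEuler_euler :
    IsEuler euler (X 0 : MvPowerSeries (Fin 3) ℚ) (X 1) (X 2) := by
  constructor <;> first | exact euler_X_self _ | exact euler_X_of_ne (by decide)

/-- The exponent `(n, n, n)`. -/
noncomputable def diagExp (n : ℕ) : Fin 3 →₀ ℕ := Finsupp.equivFunOnFinite.symm fun _ => n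

@[simp] theorem diagExp_apply (n : ℕ) (i : Fin 3) : diagExp n i = n := rfl

/-- The diagonal of a power series in three variables. -/
noncomputable def diag : MvPowerSeries (Fin 3) ℚ →ₗ[ℚ] PowerSeries ℚ where
  toFun f := PowerSeries.mk fun n => coeff (diagExp n) f
  map_add' f g := by ext; simp
  map_smul' c f := by ext; simp

@[simp] theorem coeff_diag (f : MvPowerSeries (Fin 3) ℚ) (n : ℕ) :
    PowerSeries.coeff n (diag f) = coeff (diagExp n) f := by
  simp [diag]

/-- All three Euler operators induce the operator `X d/dX` on diagonals; hence the differences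
`euler i f - euler j f` have diagonal zero. -/
theorem diag_euler (i : Fin 3) (f : MvPowerSeries (Fin 3) ℚ) :
    diag (euler i f) = PowerSeries.X * PowerSeries.derivative ℚ (diag f) := by
  ext n
  rw [coeff_diag, coeff_euler, diagExp_apply]
  cases n with
  | zero => simp
  | succ n =>
    rw [PowerSeries.coeff_succ_X_mul, PowerSeries.coeff_derivative, coeff_diag]
    push_cast
    ring

theorem diag_prod_X_mul (f : MvPowerSeries (Fin 3) ℚ) :
    diag (X 0 * X 1 * X 2 * f) = PowerSeries.X * diag f := by
  have h : (X 0 * X 1 * X 2 : MvPowerSeries (Fin 3) ℚ) = monomial (diagExp 1) 1 := by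
    rw [X_def, X_def, X_def, monomial_mul_monomial, monomial_mul_monomial, one_mul, one_mul]
    congr 2
    ext i
    fin_cases i <;> simp
  ext n
  rw [h, coeff_diag, coeff_monomial_mul]
  cases n with
  | zero =>
    rw [if_neg, PowerSeries.coeff_zero_X_mul]
    intro h
    simpa using h 0
  | succ n =>
    have e : diagExp (n + 1) = diagExp n + diagExp 1 := by ext i; simp
    rw [PowerSeries.coeff_succ_X_mul, coeff_diag, e, if_pos le_add_self, add_tsub_cancel_right,
      one_mul]

/-- Taking diagonals is linear over the polynomials in `X 0 * X 1 * X 2`, which act on univariate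
power series as polynomials in `X`. -/
theorem diag_aeval_mul (p : Polynomial ℚ) (f : MvPowerSeries (Fin 3) ℚ) :
    diag (Polynomial.aeval (X 0 * X 1 * X 2 : MvPowerSeries (Fin 3) ℚ) p * f)
      = (p : PowerSeries ℚ) * diag f := by
  induction p using Polynomial.induction_on' with
  | add p q hp hq => simp only [map_add, add_mul, Polynomial.coe_add, hp, hq]
  | monomial n c =>
    induction n generalizing f with
    | zero =>
      simp only [Polynomial.monomial_zero_left, Polynomial.aeval_C, Polynomial.coe_C,
        ← Algebra.smul_def, map_smul]
      rw [PowerSeries.smul_eq_C_mul]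
    | succ n ih =>
      rw [← Polynomial.monomial_mul_X, map_mul (Polynomial.aeval _), Polynomial.aeval_X, mul_assoc,
        ih, diag_prod_X_mul, Polynomial.coe_mul, Polynomial.coe_X, mul_assoc]

end Diagonal

/-! ### The generating function of rook paths -/

section Counting

open MvPowerSeries Finset

/-- The cell with the coordinates `n 0`, `n 1`, `n 2`. -/
def cell (n : Fin 3 →₀ ℕ) : ℕ × ℕ × ℕ := (n 0, n 1, n 2)

theorem cell_add (m n : Fin 3 →₀ ℕ) : cell (m + n) = cell m + cell n := rfl

theorem cell_injective : Function.Injective cell := by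
  intro m n h
  simp only [cell, Prod.mk.injEq] at h
  ext i
  fin_cases i
  exacts [h.1, h.2.1, h.2.2]

theorem cell_surjective : Function.Surjective cell := by
  rintro ⟨i, j, k⟩
  exact ⟨Finsupp.equivFunOnFinite.symm ![i, j, k], rfl⟩

open Classical in
/-- The generating function of the moves of a 3D rook. -/
noncomputable def moveSeries : MvPowerSeries (Fin 3) ℚ :=
  fun n => if IsMove (cell n) then 1 else 0

/-- The generating function of the numbers of 3D rook paths to the cells. -/
noncomputable def rookSeries : MvPowerSeries (Fin 3) ℚ := fun n => r (cell n)

open Classical in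
/-- A rook path is empty or consists of a first move and a rook path covering the remaining
displacement. -/
theorem toFinset_paths (n : Fin 3 →₀ ℕ) :
    (paths_finite (cell n)).toFinset = (if n = 0 then {[]} else ∅) ∪
      ((antidiagonal n).filter fun p => IsMove (cell p.1)).biUnion fun p =>
        (paths_finite (cell p.2)).toFinset.image (List.cons (cell p.1)) := by
  ext l
  simp only [Set.Finite.mem_toFinset, mem_union, mem_biUnion, mem_filter,
    HasAntidiagonal.mem_antidiagonal, mem_image, paths, Set.mem_ofPred_eq]
  cases l with
  | nil =>
    have h0 : (0 : ℕ × ℕ × ℕ) = cell n ↔ n = 0 :=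
      ⟨fun h => cell_injective h.symm, fun h => by rw [h]; rfl⟩
    by_cases hn : n = 0
    · subst hn
      simp [show (0 : ℕ × ℕ × ℕ) = cell 0 from rfl]
    · simp [h0, hn]
  | cons v l =>
    obtain ⟨a, rfl⟩ := cell_surjective v
    have hnil : List.cons (cell a) l ∉ (if n = 0 then {[]} else ∅ : Finset _) := by
      split_ifs <;> simp
    simp only [hnil, false_or, List.forall_mem_cons, List.sum_cons, List.cons.injEq]
    constructor
    · rintro ⟨⟨ha, hl⟩, hs⟩
      obtain ⟨b, hb⟩ := cell_surjective l.sum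
      rw [← hb, ← cell_add] at hs
      exact ⟨(a, b), ⟨cell_injective hs, ha⟩, l, ⟨hl, hb.symm⟩, rfl, rfl⟩
    · rintro ⟨⟨a', b⟩, ⟨hab, ha⟩, l', ⟨hl, hs⟩, ha', rfl⟩
      refine ⟨⟨ha' ▸ ha, hl⟩, ?_⟩
      rw [hs, ← ha', ← cell_add, hab]

theorem rookSeries_eq : rookSeries = 1 + moveSeries * rookSeries := by
  classical
  ext n
  have hr (m : Fin 3 →₀ ℕ) : r (cell m) = #(paths_finite (cell m)).toFinset :=
    Set.ncard_eq_toFinset_card _ _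
  have hcard : r (cell n) = (if n = 0 then 1 else 0) +
      ∑ p ∈ antidiagonal n, (if IsMove (cell p.1) then 1 else 0) * r (cell p.2) := by
    rw [hr, toFinset_paths, card_union_of_disjoint, card_biUnion, sum_filter]
    · congr 1
      · split_ifs <;> rfl
      · refine sum_congr rfl fun p _ => ?_
        split_ifs
        · rw [one_mul, hr, card_image_of_injective _ List.cons_injective]
        · rw [zero_mul]
    · intro p hp q hq hpq
      rw [Function.onFun, disjoint_left]
      intro l hl hl'
      obtain ⟨l₁, -, rfl⟩ := mem_image.1 hl
      obtain ⟨l₂, -, h⟩ := mem_image.1 hl'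
      have h1 : q.1 = p.1 := cell_injective (List.cons.inj h).1
      have hp' := HasAntidiagonal.mem_antidiagonal.1 (mem_filter.1 hp).1
      have hq' := HasAntidiagonal.mem_antidiagonal.1 (mem_filter.1 hq).1
      refine hpq (Prod.ext h1.symm (add_left_cancel (a := p.1) ?_))
      rw [hp', ← hq', h1]
    · rw [disjoint_left]
      intro l hl hl'
      obtain ⟨p, -, hp⟩ := mem_biUnion.1 hl'
      obtain ⟨l₁, -, rfl⟩ := mem_image.1 hp
      split_ifs at hl <;> simp at hl
  rw [map_add, coeff_mul, coeff_one]
  change ((r (cell n) : ℕ) : ℚ) = _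
  rw [hcard]
  push_cast
  congr 1

open Classical in
/-- The generating function `Xᵢ + Xᵢ² + ⋯` of the moves in the `i`-th direction. -/
noncomputable def axisSeries (i : Fin 3) : MvPowerSeries (Fin 3) ℚ :=
  fun n => if ∃ m, n = Finsupp.single i (m + 1) then 1 else 0

theorem one_sub_X_mul_axisSeries (i : Fin 3) : (1 - X i) * axisSeries i = X i := by
  classical
  rw [sub_mul, one_mul, sub_eq_iff_eq_add]
  ext n
  rw [map_add, X_def, coeff_monomial_mul, coeff_monomial]
  change (if _ then _ else _) = _ + if _ then (1 : ℚ) * (if _ then _ else _) else _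
  by_cases hn : ∃ m, n = Finsupp.single i (m + 1)
  · obtain ⟨m, rfl⟩ := hn
    have h1 : Finsupp.single i 1 ≤ Finsupp.single i (m + 1) := by simp
    rw [if_pos ⟨m, rfl⟩, if_pos h1, ← Finsupp.single_tsub, Nat.add_sub_cancel]
    cases m with
    | zero =>
      rw [if_pos rfl, if_neg, mul_zero, add_zero]
      rintro ⟨k, hk⟩
      simpa using DFunLike.congr_fun hk i
    | succ m =>
      rw [if_neg (by simp), if_pos ⟨m, rfl⟩]
      norm_num
  · rw [if_neg hn, if_neg (fun h => hn ⟨0, h⟩)]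
    split_ifs with h1 h2
    · obtain ⟨m, hm⟩ := h2
      refine absurd ⟨m + 1, ?_⟩ hn
      rw [← tsub_add_cancel_of_le h1, hm, ← Finsupp.single_add]
    · simp
    · simp

theorem moveSeries_eq : moveSeries = axisSeries 0 + axisSeries 1 + axisSeries 2 := by
  classical
  ext n
  have key (i : Fin 3) (m : ℕ) :
      n = Finsupp.single i m ↔ n 0 = Finsupp.single i m 0 ∧ n 1 = Finsupp.single i m 1 ∧
        n 2 = Finsupp.single i m 2 := by
    rw [Finsupp.ext_iff, Fin.forall_fin_succ, Fin.forall_fin_two]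
    rfl
  rw [map_add, map_add]
  change (if IsMove (cell n) then (1 : ℚ) else 0) = (if _ then _ else _) + (if _ then _ else _) +
    if _ then _ else _
  have h0 : (∃ m, n = Finsupp.single 0 (m + 1)) ↔ 1 ≤ n 0 ∧ n 1 = 0 ∧ n 2 = 0 := by
    simp only [key, Finsupp.single_apply]
    exact ⟨fun ⟨m, h⟩ => by simp at h; omega, fun h => ⟨n 0 - 1, by simp; omega⟩⟩
  have h1 : (∃ m, n = Finsupp.single 1 (m + 1)) ↔ n 0 = 0 ∧ 1 ≤ n 1 ∧ n 2 = 0 := by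
    simp only [key, Finsupp.single_apply]
    exact ⟨fun ⟨m, h⟩ => by simp at h; omega, fun h => ⟨n 1 - 1, by simp; omega⟩⟩
  have h2 : (∃ m, n = Finsupp.single 2 (m + 1)) ↔ n 0 = 0 ∧ n 1 = 0 ∧ 1 ≤ n 2 := by
    simp only [key, Finsupp.single_apply]
    exact ⟨fun ⟨m, h⟩ => by simp at h; omega, fun h => ⟨n 2 - 1, by simp; omega⟩⟩
  have hm : IsMove (cell n) ↔ (1 ≤ n 0 ∧ n 1 = 0 ∧ n 2 = 0) ∨ (n 0 = 0 ∧ 1 ≤ n 1 ∧ n 2 = 0) ∨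
      (n 0 = 0 ∧ n 1 = 0 ∧ 1 ≤ n 2) := by
    simp only [IsMove, cell, Prod.mk.injEq]
    constructor
    · rintro ⟨m, hm, h⟩
      omega
    · rintro (h | h | h)
      exacts [⟨n 0, by omega⟩, ⟨n 1, by omega⟩, ⟨n 2, by omega⟩]
  simp only [h0, h1, h2, hm]
  split_ifs <;> first | omega | norm_num

theorem denom_mul_rookSeries :
    denom (X 0) (X 1) (X 2) * rookSeries = (1 - X 0) * (1 - X 1) * (1 - X 2) := by
  have h := rookSeries_eq
  rw [moveSeries_eq] at h
  have h0 := one_sub_X_mul_axisSeries 0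
  have h1 := one_sub_X_mul_axisSeries 1
  have h2 := one_sub_X_mul_axisSeries 2
  rw [denom]
  linear_combination (1 - X 0) * (1 - X 1) * (1 - X 2) * h
    + (1 - X 1) * (1 - X 2) * rookSeries * h0 + (1 - X 0) * (1 - X 2) * rookSeries * h1
    + (1 - X 0) * (1 - X 1) * rookSeries * h2

theorem diag_rookSeries : diag rookSeries = G := by
  ext n
  rw [coeff_diag, G, PowerSeries.coeff_mk]
  rfl

end Counting

/-! ### The differential system of the diagonal -/

section Relations

theorem denom_mul_inv :
    denom (MvPowerSeries.X 0) (MvPowerSeries.X 1) (MvPowerSeries.X 2) *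
      (denom (MvPowerSeries.X 0) (MvPowerSeries.X 1) (MvPowerSeries.X 2) :
        MvPowerSeries (Fin 3) ℚ)⁻¹ = 1 :=
  MvPowerSeries.mul_inv_cancel _ (by simp [denom])

/-- The diagonal of the reciprocal of the denominator of the generating function of 3D rook
paths. -/
noncomputable def diagInv : PowerSeries ℚ :=
  diag (denom (MvPowerSeries.X 0) (MvPowerSeries.X 1) (MvPowerSeries.X 2))⁻¹

open MvPowerSeries in
theorem rookSeries_eq_mul_inv : rookSeries = (1 - X 0) * (1 - X 1) * (1 - X 2) *
    (denom (X 0) (X 1) (X 2) : MvPowerSeries (Fin 3) ℚ)⁻¹ := by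
  linear_combination (denom (X 0) (X 1) (X 2) : MvPowerSeries (Fin 3) ℚ)⁻¹ * denom_mul_rookSeries
    - rookSeries * denom_mul_inv

/-- The exact elements, as the telescoping identities produce them, have diagonal zero. -/
theorem diag_exact (A B : MvPowerSeries (Fin 3) ℚ) :
    diag ((euler 0 A - euler 2 A) + (euler 1 B - euler 2 B)) = 0 := by
  simp only [map_add, map_sub, diag_euler, sub_self, add_zero]

theorem coe_ofNat (n : ℕ) [n.AtLeastTwo] :
    ((ofNat(n) : Polynomial ℚ) : PowerSeries ℚ) = ofNat(n) :=
  map_ofNat Polynomial.coeToPowerSeries.ringHom n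

open PowerSeries

theorem ofNat_ne_zero (n : ℕ) [n.AtLeastTwo] : (ofNat(n) : PowerSeries ℚ) ≠ 0 := fun h => by
  simpa [map_ofNat] using congrArg constantCoeff h

/-- The relation on diagonals given by `IsEuler.first_telescoper`. -/
theorem derivative_G_eq :
    (2 + 12 * X) * derivative ℚ G = (1 - X) * derivative ℚ ((1 - 4 * X) * diagInv) := by
  obtain ⟨A, B, h⟩ := isEuler_euler.first_telescoper denom_mul_inv
  have h2 (f) : diag ((2 + 12 * (.X 0 * .X 1 * .X 2)) * f) = (2 + 12 * X) * diag f := by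
    simpa [map_ofNat, coe_ofNat] using diag_aeval_mul (2 + 12 * .X) f
  have h1 (f) : diag ((1 - .X 0 * .X 1 * .X 2) * f) = (1 - X) * diag f := by
    simpa [map_ofNat, coe_ofNat] using diag_aeval_mul (1 - .X) f
  have h4 (f) : diag ((1 - 4 * (.X 0 * .X 1 * .X 2)) * f) = (1 - 4 * X) * diag f := by
    simpa [map_ofNat, coe_ofNat] using diag_aeval_mul (1 - 4 * .X) f
  have h3 (f) : diag (3 * f) = 3 * diag f := by
    simpa [map_ofNat, coe_ofNat] using diag_aeval_mul 3 f
  have := congrArg diag h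
  rw [diag_exact, h3, map_sub, h2, h1, ← rookSeries_eq_mul_inv, diag_euler, diag_euler, h4,
    diag_rookSeries, ← diagInv] at this
  refine mul_left_cancel₀ (mul_ne_zero (ofNat_ne_zero 3) X_ne_zero) ?_
  linear_combination this

/-- The relation on diagonals given by `IsEuler.second_telescoper`. -/
theorem derivative_derivative_G_eq :
    (1 - 4 * X) * derivative ℚ ((2 - 3 * X) * (1 - 64 * X) * (X * derivative ℚ G))
      + 8 * ((2 - 3 * X) * (1 - 64 * X) * (X * derivative ℚ G))
      = 12 * ((1 - X) * (1 + 6 * X)) * diagInv := by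
  obtain ⟨A, B, h⟩ := isEuler_euler.second_telescoper denom_mul_inv
  have h4 (f) : diag ((1 - 4 * (.X 0 * .X 1 * .X 2)) * f) = (1 - 4 * X) * diag f := by
    simpa [map_ofNat, coe_ofNat] using diag_aeval_mul (1 - 4 * .X) f
  have hQ (f) : diag ((2 - 3 * (.X 0 * .X 1 * .X 2)) * (1 - 64 * (.X 0 * .X 1 * .X 2)) * f)
      = (2 - 3 * X) * (1 - 64 * X) * diag f := by
    simpa [map_ofNat, coe_ofNat] using diag_aeval_mul ((2 - 3 * .X) * (1 - 64 * .X)) f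
  have h8 (f) : diag (8 * (.X 0 * .X 1 * .X 2) * f) = 8 * X * diag f := by
    simpa [map_ofNat, coe_ofNat] using diag_aeval_mul (8 * .X) f
  have h12 (f) : diag (12 * (.X 0 * .X 1 * .X 2) * f) = 12 * X * diag f := by
    simpa [map_ofNat, coe_ofNat] using diag_aeval_mul (12 * .X) f
  have h6 (f) : diag ((1 - .X 0 * .X 1 * .X 2) * (1 + 6 * (.X 0 * .X 1 * .X 2)) * f)
      = (1 - X) * (1 + 6 * X) * diag f := by
    simpa [map_ofNat, coe_ofNat] using diag_aeval_mul ((1 - .X) * (1 + 6 * .X)) f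
  have h18 (f) : diag (18 * f) = 18 * diag f := by
    simpa [map_ofNat, coe_ofNat] using diag_aeval_mul 18 f
  have := congrArg diag h
  rw [diag_exact, h18, map_sub, map_add, h4, h8, h12, h6, ← rookSeries_eq_mul_inv, diag_euler, hQ,
    diag_euler, diag_rookSeries, ← diagInv] at this
  refine mul_left_cancel₀ (mul_ne_zero (ofNat_ne_zero 18) X_ne_zero) ?_
  linear_combination this

theorem constantCoeff_diagInv : constantCoeff diagInv = 1 := by
  rw [← coeff_zero_eq_constantCoeff_apply, diagInv, coeff_diag,
    show diagExp 0 = 0 from Finsupp.ext fun _ => rfl,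
    MvPowerSeries.coeff_zero_eq_constantCoeff_apply]
  simp [MvPowerSeries.constantCoeff_inv, denom]

theorem constantCoeff_G : constantCoeff G = 1 := by
  rw [← coeff_zero_eq_constantCoeff_apply, ← diag_rookSeries, coeff_diag,
    show diagExp 0 = 0 from Finsupp.ext fun _ => rfl,
    MvPowerSeries.coeff_zero_eq_constantCoeff_apply]
  simpa [denom] using congrArg MvPowerSeries.constantCoeff denom_mul_rookSeries

theorem derivative_X_pow_succ_mul (n : ℕ) (w : PowerSeries ℚ) :
    derivative ℚ (X ^ (n + 1) * w) = X ^ n * ((n + 1 : ℚ) • w + X * derivative ℚ w) := by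
  simp only [Derivation.leibniz, Derivation.leibniz_pow, derivative_X, smul_eq_mul, nsmul_eq_mul,
    add_tsub_cancel_right, smul_eq_C_mul, map_add, map_natCast, map_one]
  push_cast
  ring

/-- The system satisfied by `(G', diagInv)` has no nonzero solution with `v(0) = 0`: if `X ^ n ∣ u`
and `X ^ (n + 1) ∣ v`, then the lowest terms of the second and the first equation force the next
coefficient of `u` and of `v`, in this order, to vanish. -/
theorem eq_zero_of_system {u v : PowerSeries ℚ} (h0 : constantCoeff v = 0)
    (h1 : (2 + 12 * X) * u = (1 - X) * derivative ℚ ((1 - 4 * X) * v))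
    (h2 : (1 - 4 * X) * derivative ℚ ((2 - 3 * X) * (1 - 64 * X) * (X * u))
      + 8 * ((2 - 3 * X) * (1 - 64 * X) * (X * u)) = 12 * ((1 - X) * (1 + 6 * X)) * v) :
    u = 0 := by
  have key (n : ℕ) : X ^ n ∣ u ∧ X ^ (n + 1) ∣ v := by
    induction n with
    | zero => simpa using X_dvd_iff.2 h0
    | succ n ih =>
      obtain ⟨⟨u, rfl⟩, ⟨v, rfl⟩⟩ := ih
      have hn : (n + 1 : ℚ) ≠ 0 := by positivity
      have hu : X ∣ u := by
        rw [show (2 - 3 * X) * (1 - 64 * X) * (X * (X ^ n * u))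
          = X ^ (n + 1) * ((2 - 3 * X) * (1 - 64 * X) * u) by ring, derivative_X_pow_succ_mul] at h2
        have h := mul_left_cancel₀ (pow_ne_zero n X_ne_zero) (show X ^ n * ((1 - 4 * X) *
          ((n + 1 : ℚ) • ((2 - 3 * X) * (1 - 64 * X) * u)
            + X * derivative ℚ ((2 - 3 * X) * (1 - 64 * X) * u))
          + 8 * (X * ((2 - 3 * X) * (1 - 64 * X) * u)))
          = X ^ n * (12 * ((1 - X) * (1 + 6 * X)) * (X * v)) by linear_combination h2)
        have h := congrArg constantCoeff h
        rw [X_dvd_iff]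
        simpa [map_ofNat, smul_eq_C_mul, hn] using h
      obtain ⟨u, rfl⟩ := hu
      rw [show (1 - 4 * X) * (X ^ (n + 1) * v) = X ^ (n + 1) * ((1 - 4 * X) * v) by ring,
        derivative_X_pow_succ_mul] at h1
      have h := mul_left_cancel₀ (pow_ne_zero n X_ne_zero) (show X ^ n * ((2 + 12 * X) * (X * u))
        = X ^ n * ((1 - X) * ((n + 1 : ℚ) • ((1 - 4 * X) * v)
          + X * derivative ℚ ((1 - 4 * X) * v))) by linear_combination h1)
      have h := congrArg constantCoeff h
      have hv : X ∣ v := by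
        rw [X_dvd_iff]
        simpa [map_ofNat, smul_eq_C_mul, hn] using h
      obtain ⟨v, rfl⟩ := hv
      exact ⟨⟨u, by ring⟩, ⟨v, by ring⟩⟩
  ext n
  exact X_pow_dvd_iff.1 (key (n + 1)).1 n n.lt_succ_self

end Relations

/-! ### The hypergeometric solution -/

section Hypergeometric

open PowerSeries

theorem coeff_hyp_succ (n : ℕ) :
    (n + 1) * (n + 2) * coeff (n + 1) (hyp (1 / 3) (2 / 3) 2)
      = (n + 1 / 3) * (n + 2 / 3) * coeff n (hyp (1 / 3) (2 / 3) 2) := by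
  have h2 : (ascPochhammer ℚ n).eval 2 ≠ 0 := (ascPochhammer_pos n 2 (by norm_num)).ne'
  have hn : (n + 1 : ℚ) ≠ 0 := by positivity
  have hn' : (2 + n : ℚ) ≠ 0 := by positivity
  have hf : (n.factorial : ℚ) ≠ 0 := by positivity
  simp only [hyp, coeff_mk, ordinaryHypergeometricCoefficient, ascPochhammer_succ_eval,
    Nat.factorial_succ]
  push_cast
  field_simp
  ring

/-- The differential equation of `₂F₁(1/3, 2/3; 2; X)`. -/
theorem hyp_ode : (1 - X) * (2 * derivative ℚ (hyp (1 / 3) (2 / 3) 2)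
      + X * derivative ℚ (derivative ℚ (hyp (1 / 3) (2 / 3) 2)))
      = C (2 / 9 : ℚ) * hyp (1 / 3) (2 / 3) 2 := by
  set f := hyp (1 / 3) (2 / 3) 2 with hf
  have h2 (n : ℕ) (g : PowerSeries ℚ) : coeff n (2 * g) = 2 * coeff n g := by
    rw [two_mul, map_add, two_mul]
  rw [sub_mul, one_mul]
  ext n
  have h := coeff_hyp_succ n
  rw [← hf] at h
  rw [map_sub, coeff_C_mul]
  rcases n with _ | n
  · simp only [map_add, h2, coeff_derivative, coeff_zero_X_mul]
    push_cast at h ⊢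
    linear_combination h
  rcases n with _ | n
  · simp only [map_add, h2, coeff_derivative, coeff_succ_X_mul, coeff_zero_X_mul]
    push_cast at h ⊢
    linear_combination h
  · simp only [map_add, h2, coeff_derivative, coeff_succ_X_mul]
    push_cast at h ⊢
    linear_combination h

theorem one_sub_four_X_ne_zero : (1 - 4 * X : PowerSeries ℚ) ≠ 0 := fun h => by
  simpa [map_ofNat] using congrArg constantCoeff h

theorem one_sub_sixtyfour_X_ne_zero : (1 - 64 * X : PowerSeries ℚ) ≠ 0 := fun h => by
  simpa [map_ofNat] using congrArg constantCoeff h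

theorem derivative_arg_mul :
    derivative ℚ arg * (1 - 4 * X) ^ 4 = 54 * ((1 - X) * (1 + 6 * X)) := by
  have h := congrArg (derivative ℚ) arg_mul
  simp only [Derivation.leibniz, Derivation.leibniz_pow, map_sub, derivation_ofNat,
    Derivation.map_one_eq_zero, derivative_X, smul_eq_mul, nsmul_eq_mul, Nat.reduceSub] at h
  push_cast at h
  linear_combination (1 - 4 * X) * h + 12 * arg_mul

/-- The differential equation of `₂F₁(1/3, 2/3; 2; X)` after the substitution. -/
theorem hyp_ode_subst : 9 * ((1 - arg) * (2 * (derivative ℚ (hyp (1 / 3) (2 / 3) 2)).subst arg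
      + arg * (derivative ℚ (derivative ℚ (hyp (1 / 3) (2 / 3) 2))).subst arg))
      = 2 * (hyp (1 / 3) (2 / 3) 2).subst arg := by
  have h := congrArg (9 * substAlgHom (R := ℚ) hasSubst_arg ·) hyp_ode
  have h9 : (9 : PowerSeries ℚ) * C (2 / 9 : ℚ) = 2 := by
    rw [← map_ofNat (C (R := ℚ)) 9, ← map_mul, ← map_ofNat (C (R := ℚ)) 2]
    norm_num
  have hC : substAlgHom (R := ℚ) hasSubst_arg (C (2 / 9 : ℚ)) = C (2 / 9 : ℚ) :=
    AlgHom.commutes _ _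
  simp only [map_mul, map_sub, map_one, map_add, map_ofNat, substAlgHom_X, hC,
    coe_substAlgHom] at h
  linear_combination h + (hyp (1 / 3) (2 / 3) 2).subst arg * h9

theorem constantCoeff_hyp_subst :
    constantCoeff ((hyp (1 / 3) (2 / 3) 2).subst arg) = (1 : ℚ) := by
  obtain ⟨g, hg⟩ : X ∣ hyp (1 / 3) (2 / 3) 2 - 1 := by
    rw [X_dvd_iff, map_sub, ← coeff_zero_eq_constantCoeff_apply]
    simp [hyp, ordinaryHypergeometricCoefficient]
  rw [sub_eq_iff_eq_add.1 hg, ← coe_substAlgHom hasSubst_arg, map_add, map_mul, map_one,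
    substAlgHom_X]
  simp [arg]

/-- The series `u = 6 φ / ((1 - 4 X)(1 - 64 X))` with `φ = ₂F₁(1/3, 2/3; 2; arg)` solves, together
with `v = ₂F₁(1/3, 2/3; 1; arg) / (1 - 4 X)`, the same system as `(G', diagInv)`; here
`₂F₁(1/3, 2/3; 1; z)` is written as the derivative of `z ₂F₁(1/3, 2/3; 2; z)`. -/
theorem derivative_G_eq_hyp :
    derivative ℚ G = 6 * ((1 - 4 * X) * (1 - 64 * X))⁻¹ * (hyp (1 / 3) (2 / 3) 2).subst arg := by
  set φ : PowerSeries ℚ := (hyp (1 / 3) (2 / 3) 2).subst arg with hφ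
  set φ₁ : PowerSeries ℚ := (derivative ℚ (hyp (1 / 3) (2 / 3) 2)).subst arg
  set φ₂ : PowerSeries ℚ := (derivative ℚ (derivative ℚ (hyp (1 / 3) (2 / 3) 2))).subst arg
  set u : PowerSeries ℚ := 6 * ((1 - 4 * X) * (1 - 64 * X))⁻¹ * φ with hu
  set v : PowerSeries ℚ := (1 - 4 * X)⁻¹ * (φ + arg * φ₁) with hv
  have hu' : (1 - 4 * X) * (1 - 64 * X) * u = 6 * φ := by
    have := PowerSeries.mul_inv_cancel ((1 - 4 * X) * (1 - 64 * X) : PowerSeries ℚ)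
      (by simp [map_ofNat])
    rw [hu]
    linear_combination 6 * φ * this
  have hv' : (1 - 4 * X) * v = φ + arg * φ₁ := by
    rw [hv, ← mul_assoc, PowerSeries.mul_inv_cancel _ (by simp [map_ofNat]), one_mul]
  have dφ : derivative ℚ φ = φ₁ * derivative ℚ arg := derivative_subst hasSubst_arg
  have dφ₁ : derivative ℚ φ₁ = φ₂ * derivative ℚ arg := derivative_subst hasSubst_arg
  have h1 : (2 + 12 * X) * u = (1 - X) * derivative ℚ ((1 - 4 * X) * v) := by
    rw [hv', map_add, Derivation.leibniz, dφ, dφ₁, smul_eq_mul, smul_eq_mul]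
    refine mul_left_cancel₀ (mul_ne_zero (pow_ne_zero 4 one_sub_four_X_ne_zero)
      one_sub_sixtyfour_X_ne_zero) ?_
    -- The factor `1 - arg` of the hypergeometric equation is
    -- `(1 - X) ^ 2 * (1 - 64 * X) / (1 - 4 * X) ^ 3`.
    linear_combination (2 + 12 * X) * (1 - 4 * X) ^ 3 * hu'
      - (1 - X) * (1 - 64 * X) * (2 * φ₁ + arg * φ₂) * derivative_arg_mul
      - 6 * (1 + 6 * X) * (1 - 4 * X) ^ 3 * hyp_ode_subst
      - 54 * (1 + 6 * X) * (2 * φ₁ + arg * φ₂) * arg_mul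
  have h2 : (1 - 4 * X) * derivative ℚ ((2 - 3 * X) * (1 - 64 * X) * (X * u))
      + 8 * ((2 - 3 * X) * (1 - 64 * X) * (X * u)) = 12 * ((1 - X) * (1 + 6 * X)) * v := by
    set T := (2 - 3 * X) * (1 - 64 * X) * (X * u) with hT
    have hT' : (1 - 4 * X) * T = 6 * X * (2 - 3 * X) * φ := by
      linear_combination X * (2 - 3 * X) * hu'
    have dT := congrArg (derivative ℚ) hT'
    simp only [Derivation.leibniz, map_sub, derivation_ofNat,
      Derivation.map_one_eq_zero, derivative_X, smul_eq_mul, dφ] at dT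
    refine mul_left_cancel₀ (pow_ne_zero 4 one_sub_four_X_ne_zero) ?_
    linear_combination (1 - 4 * X) ^ 4 * dT + 12 * (1 - 4 * X) ^ 3 * hT'
      - 12 * ((1 - X) * (1 + 6 * X)) * (1 - 4 * X) ^ 3 * hv'
      + 6 * X * (2 - 3 * X) * φ₁ * derivative_arg_mul
      - 12 * ((1 - X) * (1 + 6 * X)) * φ₁ * arg_mul
  have h0 : constantCoeff v = 1 := by
    have harg : constantCoeff arg = 0 := by simp [arg]
    rw [hv, map_mul, map_add, map_mul constantCoeff arg, harg, hφ, constantCoeff_hyp_subst]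
    simp [map_ofNat]
  refine sub_eq_zero.1 (eq_zero_of_system (v := diagInv - v) ?_ ?_ ?_)
  · rw [map_sub, h0, constantCoeff_diagInv, sub_self]
  · rw [mul_sub, mul_sub, derivative_G_eq, h1, map_sub, mul_sub]
  · rw [mul_sub X, mul_sub (_ * _) (X * _), map_sub]
    linear_combination derivative_derivative_G_eq - h2

theorem derivative_integral (f : PowerSeries ℚ) : derivative ℚ (integral f) = f := by
  ext n
  have hn : (n + 1 : ℚ) ≠ 0 := by positivity
  rw [coeff_derivative, integral, coeff_succ_X_mul, coeff_mk, div_mul_cancel₀ _ hn]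

end Hypergeometric

end Rook3D

theorem mainTheorem3 :
    PowerSeries.derivative ℚ Rook3D.G =
      6 * ((1 - 4 * PowerSeries.X) * (1 - 64 * PowerSeries.X))⁻¹ *
        (Rook3D.hyp (1 / 3) (2 / 3) 2).subst Rook3D.arg ∧
    Rook3D.G = 1 + 6 * Rook3D.integral
      (((1 - 4 * PowerSeries.X) * (1 - 64 * PowerSeries.X))⁻¹ *
        (Rook3D.hyp (1 / 3) (2 / 3) 2).subst Rook3D.arg) := by
  refine ⟨Rook3D.derivative_G_eq_hyp, PowerSeries.derivative.ext ?_ ?_⟩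
  · rw [Rook3D.derivative_G_eq_hyp, map_add, Derivation.map_one_eq_zero, Derivation.leibniz,
      Rook3D.derivation_ofNat, Rook3D.derivative_integral, smul_zero, add_zero, zero_add,
      smul_eq_mul, mul_assoc]
  · rw [Rook3D.constantCoeff_G]
    simp [Rook3D.integral]
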